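/- Let $\mathcal T$ be a commutative semiring (addition $\oplus$, zero $0$, unit $1$) with a symmetry, that is a map $a\mapsto\ominus a$ with $\ominus(a\oplus b)=(\ominus a)\oplus(\ominus b)$, $\ominus 0=0$, $\ominus(ab)=a(\ominus b)=(\ominus a)b$ and $\ominus(\ominus a)=a$. Write $a\ominus b=a\oplus(\ominus b)$, $a^\circ=a\ominus a$, $\mathcal T^\circ=\{a^\circ: a\in\mathcal T\}$, $\mathcal T^*$ for the set of invertible elements and $\mathcal T^\vee=\mathcal T^*\cup\{0\}$. Write $a\preccurlyeq b$ if $b=a\oplus c$ for some $c\in\mathcal T$, and $b\succeq^\circ a$ if $b=a\oplus c$ for some $c\in\mathcal T^\circ$. Assume that $\preccurlyeq$ is antisymmetric ($\mathcal T$ is naturally ordered), and that $\mathcal T$ has a modulus $a\mapsto|a|$, that is a surjective semiring morphism onto an idempotent semifield $\mathcal M$ (so $0\ne1$ in $\mathcal M$ and all nonzero elements are invertible) which is totally ordered by its natural order $\preccurlyeq$. Assume further that for all $a,b\in\mathcal T$: (i) if $|a|\prec|b|$, then $a\oplus b=b$; (ii) if $a\preccurlyeq b$, $|a|=|b|$ and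 $b\in\mathcal T^\vee$, then $a=b$; (iii) $a^\circ\oplus a^\circ=a^\circ$. For a totally ordered finite set $S$, let $\mathcal P_k(S)$ be the set of its $k$-element subsets, ordered lexicographically (through their increasing enumerations). The sign of a bijection $\sigma:I\to J$ between finite totally ordered sets is $\operatorname{sign}(\sigma)=(\ominus1)^{m}$, where $m$ is the number of pairs $i<i'$ in $I$ with $\sigma(i)>\sigma(i')$. The $k$-th compound of an $S\times S$ matrix $A=(a_{s,t})$ is the $\mathcal P_k(S)\times\mathcal P_k(S)$ matrix with entries $$A^{\wedge k}_{I,J}=\bigoplus_{\sigma:I\to J\text{ bijective}}\operatorname{sign}(\sigma)\prod_{s\in I}a_{s,\sigma(s)}.$$ For an $n\times n$ matrix $A$, indexed by $[n]=\{1,\dots,n\}$, let $\det(A)=\bigoplus_{\sigma}\operatorname{sign}(\sigma)\prod_{i\in[n]}a_{i,\sigma(i)}$, over all permutations $\sigma$ of $[n]$; $A$ is nonsingular if $\det(A)\in\mathcal T^*$. Let $\operatorname{adj}(A)_{i,j}=(\ominus1)^{i+j}\det(A_{(j,i)})$, where $A_{(j,i)}$ is $A$ without row $j$ and column $i$, and,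 for nonsingular $A$, $A^\nabla=\det(A)^{-1}\operatorname{adj}(A)$. Let $D$ be the $n\times n$ diagonal matrix with $D_{i,i}=(\ominus1)^i$. Complements $I^c$, $\{i\}^c$ are taken in $[n]$. **Theorem (Tropical Jacobi identity).** Let $A\in\mathcal T^{n\times n}$ be nonsingular. Then for all $k\in\{0,\dots,n\}$ and all $I,J\in\mathcal P_k([n])$, $$\det(A)\,\big(DA^\nabla D\big)^{\wedge n-k}_{J^c,I^c}=\det(A)\,\big(\det(A)^{-1}A^{\wedge n-1}\big)^{\wedge n-k}_{\pi(I),\pi(J)}\succeq^\circ A^{\wedge k}_{I,J},$$ where $\pi:\mathcal P_k([n])\to\mathcal P_{n-k}(\mathcal P_{n-1}([n]))$ is the map $I\mapsto\{\{i\}^c: i\in I^c\}$. -/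

import Mathlib

/-- A symmetry of a (commutative) semiring: an additive map `a ↦ ⊖a` of order two
which commutes with multiplication on both sides. -/
structure SemiringSymmetry (S : Type*) [CommSemiring S] where
  /-- The underlying map `a ↦ ⊖a`. -/
  neg : S → S
  neg_add : ∀ a b, neg (a + b) = neg a + neg b
  neg_zero : neg 0 = 0
  neg_mul_right : ∀ a b, neg (a * b) = a * neg b
  neg_mul_left : ∀ a b, neg (a * b) = neg a * b
  neg_neg : ∀ a, neg (neg a) = a

/-- The relation `a ≼ b`, that is `b = a ⊕ c` for some `c`. -/
def NatLE {S : Type*} [Semiring S] (a b : S) : Prop :=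
  ∃ c, b = a + c

/-- A semiring is naturally ordered when the preorder `≼` is antisymmetric. -/
def IsNaturallyOrdered (S : Type*) [Semiring S] : Prop :=
  ∀ a b : S, NatLE a b → NatLE b a → a = b

/-- A totally ordered idempotent semifield: addition is idempotent, the natural order is total,
and the nonzero elements form a group (with `0 ≠ 1`). -/
structure IsTotallyOrderedIdempotentSemifield (M : Type*) [Semiring M] : Prop where
  add_self : ∀ a : M, a + a = a
  total : ∀ a b : M, NatLE a b ∨ NatLE b a
  isField : IsField M

/-- `S^∨ = S^* ∪ {0}`: the invertible elements together with zero. -/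
def thinSet (S : Type*) [CommSemiring S] : Set S :=
  {a | IsUnit a} ∪ {0}

namespace SemiringSymmetry

variable {S : Type*} [CommSemiring S] (τ : SemiringSymmetry S)

/-- `a° = a ⊖ a`. -/
def circ (a : S) : S := a + τ.neg a

/-- `S° = {a° : a ∈ S}`. -/
def circSet : Set S := Set.range τ.circ

/-- The relation `b ≽° a`, that is `b = a ⊕ c` for some `c ∈ S°`. -/
def CircGE (b a : S) : Prop :=
  ∃ c ∈ τ.circSet, b = a + c

/-- The sign `(⊖1)^{#inv(σ)}` of a bijection between two finite totally ordered sets,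
inversions being taken with respect to the orders of the source and of the target. -/
def sign {α β : Type*} [Fintype α] [LinearOrder α] [LinearOrder β] (σ : α ≃ β) : S :=
  (τ.neg 1) ^ (Finset.univ.filter (fun p : α × α => p.1 < p.2 ∧ σ p.2 < σ p.1)).card

/-- The determinant of a matrix whose rows and columns are indexed by two finite totally ordered
sets (of the same size; the value is `0` otherwise). Such a matrix is identified with the one
obtained by numbering the rows and the columns increasingly. -/
def det {α β : Type*} [Fintype α] [Fintype β] [LinearOrder α] [LinearOrder β]
    (A : Matrix α β S) : S :=
  ∑ σ : α ≃ β, τ.sign σ * ∏ i, A i (σ i)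

/-- The `(r,c)`-minor: the determinant of the matrix with row `r` and column `c` deleted. -/
def minor {n : ℕ} (A : Matrix (Fin n) (Fin n) S) (r c : Fin n) : S :=
  τ.det (fun (i : {i : Fin n // i ≠ r}) (j : {j : Fin n // j ≠ c}) => A i j)

/-- The adjoint matrix, `adj(A)_{i,j} = (⊖1)^{i+j} det(A_{(j,i)})`; the indices
`0, …, n-1` of `Fin n` stand for `1, …, n`. -/
def adj {n : ℕ} (A : Matrix (Fin n) (Fin n) S) : Matrix (Fin n) (Fin n) S :=
  fun i j => (τ.neg 1) ^ (((i : ℕ) + 1) + ((j : ℕ) + 1)) * τ.minor A j i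

/-- A matrix is nonsingular when its determinant is invertible. -/
def Nonsingular {n : ℕ} (A : Matrix (Fin n) (Fin n) S) : Prop :=
  IsUnit (τ.det A)

/-- The quasi-inverse `A^∇ = det(A)^{-1} adj(A)` of a nonsingular matrix. -/
noncomputable def quasiInverse {n : ℕ} (A : Matrix (Fin n) (Fin n) S) :
    Matrix (Fin n) (Fin n) S :=
  Ring.inverse (τ.det A) • τ.adj A

/-- The diagonal matrix `D` with `D_{i,i} = (⊖1)^i`, `i = 1, …, n`. -/
def altDiagonal (n : ℕ) : Matrix (Fin n) (Fin n) S :=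
  Matrix.diagonal (fun i => (τ.neg 1) ^ ((i : ℕ) + 1))

end SemiringSymmetry

/-- `P_k(S)`: the subsets of `S` with `k` elements. -/
def KSubset (α : Type*) (k : ℕ) : Type _ :=
  {I : Finset α // I.card = k}

namespace KSubset

variable {α : Type*} {k : ℕ}

/-- The lexicographic order on `P_k(S)`: two `k`-element subsets are compared through their
increasing enumerations `Fin k → S`, lexicographically. -/
noncomputable instance [LinearOrder α] : LinearOrder (KSubset α k) :=
  LinearOrder.lift' (fun I : KSubset α k => toLex (fun i : Fin k => I.1.orderEmbOfFin I.2 i))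
    (by
      intro I J h
      have h1 : (fun i : Fin k => I.1.orderEmbOfFin I.2 i) =
          (fun i : Fin k => J.1.orderEmbOfFin J.2 i) := toLex.injective h
      apply Subtype.ext
      apply Finset.coe_injective
      rw [← Finset.range_orderEmbOfFin I.1 I.2, ← Finset.range_orderEmbOfFin J.1 J.2]
      exact congrArg Set.range h1)

/-- The complement `I^c ∈ P_{n-k}([n])` of `I ∈ P_k([n])`. -/
def compl {n : ℕ} (I : KSubset (Fin n) k) : KSubset (Fin n) (n - k) :=
  ⟨(I.1)ᶜ, by rw [Finset.card_compl, Fintype.card_fin, I.2]⟩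

/-- The set `{i}^c ∈ P_{n-1}([n])`. -/
def singletonCompl {n : ℕ} (i : Fin n) : KSubset (Fin n) (n - 1) :=
  ⟨({i} : Finset (Fin n))ᶜ, by rw [Finset.card_compl, Fintype.card_fin, Finset.card_singleton]⟩

theorem singletonCompl_injective {n : ℕ} :
    Function.Injective (singletonCompl : Fin n → KSubset (Fin n) (n - 1)) := by
  intro i j h
  have h1 : ({i} : Finset (Fin n))ᶜ = ({j} : Finset (Fin n))ᶜ := congrArg Subtype.val h
  exact Finset.singleton_injective (compl_injective h1)

/-- The map `π : P_k([n]) → P_{n-k}(P_{n-1}([n]))`, `I ↦ {{i}^c : i ∈ I^c}`. -/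
def complMap {n : ℕ} (I : KSubset (Fin n) k) : KSubset (KSubset (Fin n) (n - 1)) (n - k) :=
  ⟨(I.1)ᶜ.map ⟨singletonCompl, singletonCompl_injective⟩, by
    rw [Finset.card_map, Finset.card_compl, Fintype.card_fin, I.2]⟩

end KSubset

/-- The `k`-th compound matrix of a matrix indexed by a totally ordered set: the
`P_k(α) × P_k(α)` matrix of signed sums over the bijections `I → J`,
`(A^{∧k})_{I,J} = ⊕_{σ : I → J} sign(σ) ∏_{s ∈ I} A_{s,σ(s)}`. -/
def SemiringSymmetry.compound {S : Type*} [CommSemiring S] (τ : SemiringSymmetry S)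
    {α : Type*} [LinearOrder α] (k : ℕ) (A : Matrix α α S) :
    Matrix (KSubset α k) (KSubset α k) S :=
  fun I J => τ.det (fun (s : I.1) (t : J.1) => A s t)

/-- `S`, with symmetry `τ` and modulus `μ : S → M`, `|a| = μ a`, is an extended tropical
semiring `T`: it is naturally ordered, `μ` is a surjective morphism onto a totally ordered
idempotent semifield, and the three compatibility properties hold. -/
structure IsExtendedTropical {S M : Type*} [CommSemiring S] [Semiring M]
    (τ : SemiringSymmetry S) (μ : S →+* M) : Prop where
  naturallyOrdered : IsNaturallyOrdered S
  semifield : IsTotallyOrderedIdempotentSemifield M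
  surjective : Function.Surjective μ
  /-- If `|a| ≺ |b|` then `a ⊕ b = b`. -/
  add_eq_of_lt : ∀ a b : S, NatLE (μ a) (μ b) → μ a ≠ μ b → a + b = b
  /-- If `a ≼ b`, `|a| = |b|` and `b ∈ S^∨` then `a = b`. -/
  eq_of_le : ∀ a b : S, NatLE a b → μ a = μ b → b ∈ thinSet S → a = b
  /-- `S°` is idempotent. -/
  circ_add_circ : ∀ a : S, τ.circ a + τ.circ a = τ.circ a

/-!
The proof transfers Jacobi's identity for complementary minors from the polynomial ring `ℤ[x_{ij}]`
to the semiring, and controls the cancellations that take place in `ℤ[x_{ij}]` only.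

A polynomial `p` over `ℤ` has a value `evalReduced a p` in the semiring, in which each monomial
carries its integer coefficient (`c` copies of `1`, or `-c` copies of `⊖1`). This is not a morphism,
but it is lax: a sum or product of values equals the value of the sum or product plus an element of
`S°`, because every cancellation `1 - 1 = 0` is replaced by `1 ⊖ 1`. Hence an expression built
from determinants of `A` satisfies `≽°` with respect to the reduced value of the corresponding
polynomial (`SemiringSymmetry.Dominates.det`). With `m = n - k` and `M` the matrix of unsigned
minors, the identity `det X · det M[Iᶜ,Jᶜ] = det(X)^m · X^{∧k}_{I,J}` over a commutative ring
(`SemiringSymmetry.ofRing_jacobi`) shows that `det A · det M(A)[Iᶜ,Jᶜ]` is `≽°` the reduced value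
of `det(X)^m · X^{∧k}_{I,J}`.

It remains to see that this reduced value is `det(A)^m · A^{∧k}_{I,J}`, which is `≽` it by
laxness. As `det A` is invertible, it equals one of its own terms, that of a permutation `ρ` of
maximal modulus (`IsExtendedTropical.exists_det_eq`). So `det(A)^m · A^{∧k}_{I,J}` is the signed
sum of the monomials `x_ρ^m x_σ` at `A`, over the bijections `σ : I → J`. Each of them survives in
`det(X)^m · X^{∧k}_{I,J}` with a coefficient of the right sign, since all the ways to factor it
into `m` permutations and a bijection have the same sign: splitting off one permutation `τ` leaves
the bijection `ρτ⁻¹σ` (`exists_graphExponent_switch`, `one_le_coeff_det_pow_mul_compound`). Thus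
the reduced value is also `≽ det(A)^m · A^{∧k}_{I,J}`, and the natural order is antisymmetric.
-/

/-! ### Signs, reindexing of determinants, and the two compounds -/

namespace SemiringSymmetry

section Basic

variable {S : Type*} [CommSemiring S] (τ : SemiringSymmetry S)

theorem neg_one_mul_neg_one : τ.neg 1 * τ.neg 1 = 1 := by
  rw [← τ.neg_mul_left, one_mul, τ.neg_neg]

theorem neg_one_pow_two_mul (m : ℕ) : τ.neg 1 ^ (2 * m) = 1 := by
  rw [pow_mul, pow_two, neg_one_mul_neg_one, one_pow]

variable {α β α' β' : Type*} [Fintype α] [Fintype α']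
  [LinearOrder α] [LinearOrder β] [LinearOrder α'] [LinearOrder β']

theorem sign_eq_of_equiv {σ : α ≃ β} {σ' : α' ≃ β'} (e : α × α ≃ α' × α')
    (h : ∀ p : α × α, (p.1 < p.2 ∧ σ p.2 < σ p.1) ↔
      ((e p).1 < (e p).2 ∧ σ' (e p).2 < σ' (e p).1)) :
    τ.sign σ = τ.sign σ' := by
  unfold sign
  congr 1
  exact Finset.card_equiv e fun p => by simpa using h p

theorem sign_trans_orderIso (σ : α ≃ β) (f : β ≃o β') :
    τ.sign (σ.trans f.toEquiv) = τ.sign σ :=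
  τ.sign_eq_of_equiv (Equiv.refl _) fun p => by simp

theorem sign_orderIso_trans (e : α ≃o α') (σ : α' ≃ β) :
    τ.sign (e.toEquiv.trans σ) = τ.sign σ :=
  τ.sign_eq_of_equiv (e.toEquiv.prodCongr e.toEquiv) fun p => by simp

variable [Fintype β] [Fintype β']

theorem sign_symm (σ : α ≃ β) : τ.sign σ.symm = τ.sign σ := by
  refine τ.sign_eq_of_equiv ((Equiv.prodComm _ _).trans (σ.symm.prodCongr σ.symm)) fun p => ?_
  simp [and_comm]

theorem det_transpose (A : Matrix α β S) : τ.det A.transpose = τ.det A := by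
  unfold det
  refine Fintype.sum_equiv ⟨Equiv.symm, Equiv.symm, fun _ => rfl, fun _ => rfl⟩ _ _ fun σ => ?_
  simp only [Equiv.coe_fn_mk, sign_symm, Matrix.transpose_apply]
  congr 1
  exact Fintype.prod_equiv σ _ _ fun i => by simp

theorem det_reindex (A : Matrix α' β' S) (e : α ≃o α') (f : β ≃o β') :
    τ.det (fun i j => A (e i) (f j)) = τ.det A := by
  unfold det
  refine Fintype.sum_equiv (e.toEquiv.equivCongr f.toEquiv) _ _ fun σ => ?_
  congr 1
  · exact τ.sign_eq_of_equiv (e.toEquiv.prodCongr e.toEquiv) fun p => by simp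
  · exact Fintype.prod_equiv e.toEquiv _ _ fun i => by simp

/-- Reversing the orders of the rows and of the columns simultaneously does not change the
inversions of a bijection, hence leaves the determinant unchanged. -/
theorem det_reindex_of_strictAnti (A : Matrix α' β' S) (e : α ≃ α') (f : β ≃ β')
    (he : StrictAnti e) (hf : StrictAnti f) :
    τ.det (fun i j => A (e i) (f j)) = τ.det A := by
  unfold det
  refine Fintype.sum_equiv (e.equivCongr f) _ _ fun σ => ?_
  congr 1
  · refine τ.sign_eq_of_equiv ((Equiv.prodComm _ _).trans (e.prodCongr e)) fun p => ?_
    simp [he.lt_iff_gt, hf.lt_iff_gt]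
  · exact Fintype.prod_equiv e _ _ fun i => by simp

/-- The compound of order `n - 1` collects the minors of the matrix. -/
theorem compound_singletonCompl {n : ℕ} (A : Matrix (Fin n) (Fin n) S) (i j : Fin n) :
    τ.compound (n - 1) A (KSubset.singletonCompl i) (KSubset.singletonCompl j) =
      τ.minor A i j := by
  have key : ∀ i : Fin n, ∀ x, x ∈ (KSubset.singletonCompl i).1 ↔ x ≠ i := fun i x => by
    simp [KSubset.singletonCompl]
  let e (i : Fin n) : (KSubset.singletonCompl i).1 ≃o {x : Fin n // x ≠ i} :=
    ⟨Equiv.subtypeEquivRight (key i), Iff.rfl⟩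
  exact τ.det_reindex (fun (x : {x : Fin n // x ≠ i}) (y : {x : Fin n // x ≠ j}) => A x y)
    (e i) (e j)

end Basic

end SemiringSymmetry

/-- A larger deleted index gives a lexicographically smaller complement. -/
theorem KSubset.singletonCompl_strictAnti {n : ℕ} :
    StrictAnti (KSubset.singletonCompl : Fin n → KSubset (Fin n) (n - 1)) := by
  rcases n with _ | n
  · exact fun i => i.elim0
  have key : ∀ i : Fin (n + 1), ∀ x : Fin n,
      (KSubset.singletonCompl i).1.orderEmbOfFin (KSubset.singletonCompl i).2 x =
        i.succAbove x := by
    intro i x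
    refine (congrFun (Finset.orderEmbOfFin_unique (f := i.succAbove) _ (fun x => ?_)
      i.strictMono_succAbove) x).symm
    simp [KSubset.singletonCompl, Fin.succAbove_ne]
  intro i j hij
  change Pi.Lex _ _ _ _
  have hi : (i : ℕ) < n := lt_of_lt_of_le hij (Nat.lt_succ_iff.1 j.2)
  refine ⟨(⟨i, hi⟩ : Fin n), fun x (hx : x < (⟨i, hi⟩ : Fin n)) => ?_, ?_⟩
  · refine (key j x).trans (Eq.trans ?_ (key i x).symm)
    rw [Fin.lt_def] at hx hij
    rw [Fin.succAbove_of_castSucc_lt, Fin.succAbove_of_castSucc_lt]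
    all_goals
      rw [Fin.lt_def]
      simp only [Fin.val_castSucc] at *
      omega
  · refine lt_of_eq_of_lt (key j _) (lt_of_lt_of_eq ?_ (key i _).symm)
    rw [Fin.lt_def] at hij
    rw [Fin.succAbove_of_castSucc_lt j, Fin.succAbove_of_le_castSucc i]
    · exact Fin.castSucc_lt_succ
    · rw [Fin.le_def]; simp
    · rw [Fin.lt_def]; simpa using hij

namespace SemiringSymmetry

variable {S : Type*} [CommSemiring S] (τ : SemiringSymmetry S)

theorem altDiagonal_mul_quasiInverse_mul_altDiagonal_apply {n : ℕ}
    (A : Matrix (Fin n) (Fin n) S) (i j : Fin n) :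
    (τ.altDiagonal n * τ.quasiInverse A * τ.altDiagonal n) i j =
      Ring.inverse (τ.det A) * τ.minor A j i := by
  rw [altDiagonal, Matrix.mul_diagonal, Matrix.diagonal_mul, quasiInverse, Matrix.smul_apply, adj,
    smul_eq_mul]
  calc _ = τ.neg 1 ^ (2 * (((i : ℕ) + 1) + ((j : ℕ) + 1))) *
        (Ring.inverse (τ.det A) * τ.minor A j i) := by ring
    _ = _ := by rw [neg_one_pow_two_mul, one_mul]

/-- The signs of `D` and `adj` cancel, and the transposition built into `adj` is undone by the
exchange of `I` and `J`. -/
theorem compound_quasiInverse_compl {n k : ℕ} (A : Matrix (Fin n) (Fin n) S)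
    (I J : KSubset (Fin n) k) :
    τ.compound (n - k) (τ.altDiagonal n * τ.quasiInverse A * τ.altDiagonal n) J.compl I.compl =
      τ.det (fun (i : I.compl.1) (j : J.compl.1) =>
        Ring.inverse (τ.det A) * τ.minor A i j) := by
  refine Eq.trans ?_ (τ.det_transpose _)
  simp only [compound, altDiagonal_mul_quasiInverse_mul_altDiagonal_apply]
  rfl

theorem compound_compound_complMap {n k : ℕ} (c : S) (A : Matrix (Fin n) (Fin n) S)
    (I J : KSubset (Fin n) k) :
    τ.compound (n - k) (c • τ.compound (n - 1) A) I.complMap J.complMap =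
      τ.det (fun (i : I.compl.1) (j : J.compl.1) => c * τ.minor A i j) := by
  let e (I : KSubset (Fin n) k) : I.compl.1 ≃ I.complMap.1 :=
    Equiv.ofBijective
      (fun i => ⟨KSubset.singletonCompl i, Finset.mem_map_of_mem _ i.2⟩) <| by
      refine ⟨fun i j h => Subtype.ext (KSubset.singletonCompl_injective
        (congrArg Subtype.val h)), fun ⟨x, hx⟩ => ?_⟩
      obtain ⟨i, hi, rfl⟩ := Finset.mem_map.1 hx
      exact ⟨⟨i, hi⟩, rfl⟩
  have he (I : KSubset (Fin n) k) : StrictAnti (e I) := fun i j h =>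
    KSubset.singletonCompl_strictAnti (n := n) h
  refine (τ.det_reindex_of_strictAnti _ (e I) (e J) (he I) (he J)).symm.trans ?_
  refine congrArg τ.det (funext fun i => funext fun j => ?_)
  exact congrArg (c * ·) (τ.compound_singletonCompl A i j)

end SemiringSymmetry

/-! ### Jacobi's identity over a commutative ring -/

namespace SemiringSymmetry

/-- The symmetry `a ↦ -a` of a commutative ring. -/
def ofRing (R : Type*) [CommRing R] : SemiringSymmetry R where
  neg a := -a
  neg_add a b := _root_.neg_add a b
  neg_zero := _root_.neg_zero
  neg_mul_right a b := neg_mul_eq_mul_neg a b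
  neg_mul_left a b := neg_mul_eq_neg_mul a b
  neg_neg a := _root_.neg_neg a

variable {R : Type*} [CommRing R]

theorem ofRing_sign_fin {n : ℕ} (π : Equiv.Perm (Fin n)) :
    (ofRing R).sign π = ((Equiv.Perm.sign π : ℤ) : R) := by
  have h : (Equiv.Perm.sign π : ℤˣ) = (-1) ^ (Finset.univ.filter
      (fun p : Fin n × Fin n => p.1 < p.2 ∧ π p.2 < π p.1)).card := by
    rw [Equiv.Perm.sign_eq_prod_prod_Ioi, ← Finset.prod_const, Finset.prod_filter,
      Fintype.prod_prod_type]
    refine Finset.prod_congr rfl fun i _ => ?_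
    rw [← Finset.filter_lt_eq_Ioi, Finset.prod_filter]
    refine Finset.prod_congr rfl fun j _ => ?_
    by_cases hij : i < j
    · have : π i ≠ π j := fun h => hij.ne (π.injective h)
      by_cases h2 : π i < π j
      · simp [hij, h2, h2.le]
      · simp [hij, h2, lt_of_le_of_ne (not_lt.1 h2) this.symm]
    · simp [hij]
  rw [h, sign]
  simp [ofRing]

variable {α β : Type*} [Fintype α] [LinearOrder α] [LinearOrder β]

/-- Numbering source and target increasingly turns the sign of a bijection into the sign of a
permutation. -/
theorem ofRing_sign [DecidableEq α] (σ : α ≃ β) (f : β ≃o α) :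
    (ofRing R).sign σ = ((Equiv.Perm.sign (σ.trans f.toEquiv) : ℤ) : R) := by
  let e : Fin (Fintype.card α) ≃o α := Fintype.orderIsoFinOfCardEq α rfl
  rw [← sign_trans_orderIso _ σ f, ← sign_orderIso_trans _ e,
    ← sign_trans_orderIso _ _ e.symm, ofRing_sign_fin]
  congr 2
  convert! Equiv.Perm.sign_symm_trans_trans (σ.trans f.toEquiv) e.symm.toEquiv

theorem ofRing_det [Fintype β] (A : Matrix α β R) (f : α ≃o β) :
    (ofRing R).det A = Matrix.det (A.submatrix id f) := by
  rw [← Matrix.det_transpose, Matrix.det_apply', det]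
  refine Fintype.sum_equiv ((Equiv.refl α).equivCongr f.symm.toEquiv) _ _ fun σ => ?_
  rw [ofRing_sign σ f.symm]
  congr 1
  refine Finset.prod_congr rfl fun i _ => ?_
  simp

end SemiringSymmetry

/-- The sign of a permutation that is increasing on a set and on its complement. -/
theorem SemiringSymmetry.ofRing_sign_of_strictMonoOn {R : Type*} [CommRing R] {n : ℕ}
    (φ : Equiv.Perm (Fin n)) (p : Fin n → Prop) [DecidablePred p]
    (h₁ : ∀ i j, p i → p j → i < j → φ i < φ j)
    (h₂ : ∀ i j, ¬ p i → ¬ p j → i < j → φ i < φ j) :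
    (ofRing R).sign φ = ∏ i with ¬ p i, (-1) ^ ((i : ℕ) + (φ i : ℕ)) := by
  -- An inversion pairs an index outside `p` with one inside.
  have hinv : (ofRing R).sign φ =
      ∏ i with ¬ p i, ∏ l with p l, if (l < i ↔ φ l < φ i) then (1 : R) else -1 := by
    rw [← Finset.prod_product', Finset.prod_ite, Finset.prod_const_one, one_mul,
      Finset.prod_const, sign]
    change (-1 : R) ^ _ = _
    congr 1
    refine Finset.card_bij' (fun x _ => if p x.1 then (x.2, x.1) else x)
      (fun x _ => if x.1 < x.2 then x else (x.2, x.1)) ?_ ?_ ?_ ?_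
    all_goals
      rintro ⟨i, j⟩
      have := h₁ i j
      have := h₂ i j
      have := h₁ j i
      have := h₂ j i
      have : φ i = φ j ↔ i = j := φ.injective.eq_iff
      grind
  rw [hinv]
  refine Finset.prod_congr rfl fun i hi => ?_
  have hi : ¬ p i := (Finset.mem_filter.1 hi).2
  -- Both `i` and `φ i` count the indices below them; those outside `p` are the same.
  have e₁ : (i : ℕ) = ((Finset.univ.filter p).filter (· < i)).card +
      ((Finset.univ.filter (¬ p ·)).filter (· < i)).card := by
    rw [← Fin.card_Iio i, ← Finset.card_filter_add_card_filter_not (s := Finset.Iio i) p]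
    congr 2 <;> ext <;> simp [and_comm]
  have e₂ : (φ i : ℕ) = ((Finset.univ.filter p).filter (φ · < φ i)).card +
      ((Finset.univ.filter (¬ p ·)).filter (· < i)).card := by
    have : (φ i : ℕ) = (Finset.univ.filter (φ · < φ i)).card := by
      rw [← Fin.card_Iio (φ i)]
      exact (Finset.card_equiv φ fun l => by simp).symm
    rw [this, ← Finset.card_filter_add_card_filter_not (s := Finset.univ.filter (φ · < φ i)) p]
    congr 2
    · ext; simp [and_comm]
    · ext l
      have := h₂ i l hi
      have := h₂ l i
      grind
  have e₃ : (-1 : R) ^ ((i : ℕ) + (φ i : ℕ)) =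
      (-1) ^ ((Finset.univ.filter p).filter (· < i)).card *
      (-1) ^ ((Finset.univ.filter p).filter (φ · < φ i)).card := by
    rw [← pow_add, e₁, e₂]
    exact neg_one_pow_congr (by simp only [Nat.even_add]; tauto)
  rw [e₃, ← Finset.prod_const, ← Finset.prod_const, Finset.prod_filter (· < i),
    Finset.prod_filter (φ · < φ i), ← Finset.prod_mul_distrib]
  refine Finset.prod_congr rfl fun l _ => ?_
  by_cases a : l < i <;> by_cases b : φ l < φ i <;> simp [a, b]

/-- Jacobi's identity for complementary minors over a commutative ring, up to a relabelling `φ` of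
the columns: replace the columns of `adj X` outside the block by unit vectors and multiply
by `X`. -/
theorem Matrix.det_mul_det_adjugate_block {R ι : Type*} [CommRing R] [Fintype ι] [DecidableEq ι]
    (X : Matrix ι ι R) (φ : Equiv.Perm ι) (p : ι → Prop) [DecidablePred p] :
    (Equiv.Perm.sign φ : ℤ) * X.det *
        (Matrix.of fun i j : {i // ¬ p i} => X.adjugate (φ i) j).det =
      (Matrix.of fun i j : {i // p i} => X i (φ j)).det * X.det ^ Fintype.card {i // ¬ p i} := by
  let Y : Matrix ι ι R := X.submatrix id φ
  let U : Matrix ι ι R := Matrix.of fun i j => if p j then (if i = j then 1 else 0) else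
    X.adjugate (φ i) j
  have hY : Y.det = (Equiv.Perm.sign φ : ℤ) * X.det := Matrix.det_permute' φ X
  have hYU : ∀ i j, (Y * U) i j = if p j then X i (φ j) else if i = j then X.det else 0 := by
    intro i j
    rw [Matrix.mul_apply]
    by_cases hj : p j
    · simp [Y, U, hj]
    · simp only [Y, U, hj, Matrix.submatrix_apply, Matrix.of_apply, if_false, id]
      rw [Equiv.sum_comp φ fun l => X i l * X.adjugate l j, ← Matrix.mul_apply,
        Matrix.mul_adjugate, Matrix.smul_apply, Matrix.one_apply]
      simp
  have hU : U.det = (Matrix.of fun i j : {i // ¬ p i} => X.adjugate (φ i) j).det := by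
    rw [Matrix.twoBlockTriangular_det U p]
    · have h1 : U.toSquareBlockProp p = 1 := by
        ext i j
        simp [U, Matrix.toSquareBlockProp, j.2, Matrix.one_apply, Subtype.ext_iff]
      rw [h1, Matrix.det_one, one_mul]
      congr 1
      ext i j
      simp [U, Matrix.toSquareBlockProp, j.2]
    · intro i hi j hj
      have : i ≠ j := fun h => hi (h ▸ hj)
      simp [U, hj, this]
  have hP : (Y * U).det = (Matrix.of fun i j : {i // p i} => X i (φ j)).det *
      X.det ^ Fintype.card {i // ¬ p i} := by
    rw [Matrix.twoBlockTriangular_det' (Y * U) p]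
    · congr 1
      · congr 1
        ext i j
        simp [Matrix.toSquareBlockProp, hYU, j.2]
      · have h1 : (Y * U).toSquareBlockProp (fun i => ¬ p i) =
            X.det • (1 : Matrix {i // ¬ p i} {i // ¬ p i} R) := by
          ext i j
          simp [Matrix.toSquareBlockProp, hYU, j.2, Matrix.one_apply, Subtype.ext_iff]
        rw [h1, Matrix.det_smul, Matrix.det_one, mul_one]
    · intro i hi j hj
      have : i ≠ j := fun h => hj (h ▸ hi)
      simp [hYU, hj, this]
  rw [← hP, Matrix.det_mul, hY, hU]

namespace SemiringSymmetry

theorem adjugate_eq_neg_one_pow_mul_ofRing_minor {R : Type*} [CommRing R] {n : ℕ}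
    (X : Matrix (Fin n) (Fin n) R) (i j : Fin n) :
    X.adjugate j i = (-1) ^ ((i : ℕ) + (j : ℕ)) * (ofRing R).minor X i j := by
  rcases n with _ | n
  · exact i.elim0
  rw [Matrix.adjugate_fin_succ_eq_det_submatrix, minor]
  congr 1
  let e (i : Fin (n + 1)) : Fin n ≃o {x : Fin (n + 1) // x ≠ i} :=
    ⟨finSuccAboveEquiv i, by
      intro a b
      simp only [finSuccAboveEquiv_apply, Subtype.mk_le_mk]
      exact i.strictMono_succAbove.le_iff_le⟩
  refine Eq.trans ?_ (det_reindex _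
    (fun (a : {x // x ≠ i}) (b : {x // x ≠ j}) => X a b) (e i) (e j))
  exact (ofRing_det (fun a b => X (e i a) (e j b) : Matrix (Fin n) (Fin n) R)
    (OrderIso.refl (Fin n))).symm

/-- Jacobi's identity for complementary minors over a commutative ring. With unsigned minors no sign
remains, since the relabelling that matches `I` with `J` and `Iᶜ` with `Jᶜ` increasingly has sign
`∏_{i ∈ Iᶜ} (-1)^{i + φ(i)}`. -/
theorem ofRing_jacobi_finset {R : Type*} [CommRing R] {n k : ℕ} (X : Matrix (Fin n) (Fin n) R)
    (I J : Finset (Fin n)) (hI : I.card = k) (hJ : J.card = k) :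
    (ofRing R).det X * (ofRing R).det
        (fun (i : (Iᶜ : Finset (Fin n))) (j : (Jᶜ : Finset (Fin n))) => (ofRing R).minor X i j) =
      (ofRing R).det X ^ (n - k) * (ofRing R).det (fun (i : I) (j : J) => X i j) := by
  have hc : ∀ I : Finset (Fin n), ∀ x, x ∈ Iᶜ ↔ ¬ x ∈ I := fun I x => Finset.mem_compl
  have hcompl : ∀ I : Finset (Fin n), I.card = k → (Iᶜ).card = n - k := fun I h => by
    rw [Finset.card_compl, Fintype.card_fin, h]
  let a : I ≃o J := (I.orderIsoOfFin hI).symm.trans (J.orderIsoOfFin hJ)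
  let b : (Iᶜ : Finset (Fin n)) ≃o (Jᶜ : Finset (Fin n)) :=
    ((Iᶜ).orderIsoOfFin (hcompl I hI)).symm.trans ((Jᶜ).orderIsoOfFin (hcompl J hJ))
  let c (I : Finset (Fin n)) : {x // ¬ x ∈ I} ≃o (Iᶜ : Finset (Fin n)) :=
    ⟨Equiv.subtypeEquivRight fun x => (hc I x).symm, Iff.rfl⟩
  let φ : Equiv.Perm (Fin n) :=
    Equiv.subtypeCongr (p := (· ∈ I)) (q := (· ∈ J)) a.toEquiv
      ((c I).trans (b.trans (c J).symm)).toEquiv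
  have φ₁ : ∀ i : I, φ i = a i := fun i => by
    simp [φ, Equiv.subtypeCongr]
  have φ₂ : ∀ i : (Iᶜ : Finset (Fin n)), φ i = b i := fun i => by
    have := (hc I i).1 i.2
    simp [φ, Equiv.subtypeCongr, this, Equiv.sumCompl_symm_apply_of_neg, c]
    rfl
  have hsign : ((Equiv.Perm.sign φ : ℤ) : R) = ∏ i : {i // ¬ i ∈ I},
      (-1) ^ ((i : ℕ) + (φ i : ℕ)) := by
    rw [← ofRing_sign_fin, ofRing_sign_of_strictMonoOn φ (· ∈ I)]
    · exact Finset.prod_subtype _ (by simp) _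
    · intro i j hi hj h
      rw [φ₁ ⟨i, hi⟩, φ₁ ⟨j, hj⟩]
      exact a.strictMono h
    · intro i j hi hj h
      rw [φ₂ ⟨i, (hc I i).2 hi⟩, φ₂ ⟨j, (hc I j).2 hj⟩]
      exact b.strictMono h
  have hsq : ((Equiv.Perm.sign φ : ℤ) : R) * ((Equiv.Perm.sign φ : ℤ) : R) = 1 := by
    rw [← Int.cast_mul, ← Units.val_mul, Int.units_mul_self]
    simp
  have hcard : Fintype.card {i // ¬ i ∈ I} = n - k := by
    rw [Fintype.card_congr (c I).toEquiv, Fintype.card_coe, hcompl I hI]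
  have hX : (ofRing R).det X = X.det := ofRing_det X (OrderIso.refl _)
  have hblock : (ofRing R).det (fun (i : I) (j : J) => X i j) =
      (Matrix.of fun i j : {i // i ∈ I} => X i (φ j)).det := by
    refine (ofRing_det (fun (s : I) (t : J) => X s t) a).trans ?_
    congr 1
    ext i j
    simp only [Matrix.of_apply, φ₁ j]
    rfl
  have hminors : (ofRing R).det
      (fun (i : (Iᶜ : Finset (Fin n))) (j : (Jᶜ : Finset (Fin n))) => (ofRing R).minor X i j) =
      (Matrix.of fun i j : {i // ¬ i ∈ I} => (ofRing R).minor X j (φ i)).det := by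
    refine (det_reindex _ _ (c I) ((c I).trans b)).symm.trans ?_
    rw [← Matrix.det_transpose]
    refine (ofRing_det _ (OrderIso.refl _)).trans (congrArg Matrix.det (Matrix.ext fun i j => ?_))
    exact congrArg ((ofRing R).minor X i) (φ₂ (c I j)).symm
  have hadj : (Matrix.of fun i j : {i // ¬ i ∈ I} => X.adjugate (φ i) j).det =
      (Equiv.Perm.sign φ : ℤ) *
        (Matrix.of fun i j : {i // ¬ i ∈ I} => (ofRing R).minor X j (φ i)).det := by
    simp only [hsign, pow_add, Finset.prod_mul_distrib]
    rw [mul_assoc, ← Matrix.det_mul_column, ← Matrix.det_mul_row]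
    congr 1
    ext i j
    simp only [Matrix.of_apply, adjugate_eq_neg_one_pow_mul_ofRing_minor]
    ring
  have key : ((Equiv.Perm.sign φ : ℤ) : R) * X.det *
      (Matrix.of fun i j : {i // ¬ i ∈ I} => X.adjugate (φ i) j).det =
      (Matrix.of fun i j : {i // i ∈ I} => X i (φ j)).det *
        X.det ^ Fintype.card {i // ¬ i ∈ I} := by
    convert! X.det_mul_det_adjugate_block φ (· ∈ I)
  rw [hadj, hcard] at key
  rw [hminors, hblock, hX]
  linear_combination key - X.det * (Matrix.of fun i j : {i // ¬ i ∈ I} =>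
    (ofRing R).minor X j (φ i)).det * hsq

theorem ofRing_jacobi {R : Type*} [CommRing R] {n k : ℕ} (X : Matrix (Fin n) (Fin n) R)
    (I J : KSubset (Fin n) k) :
    (ofRing R).det X *
        (ofRing R).det (fun (i : I.compl.1) (j : J.compl.1) => (ofRing R).minor X i j) =
      (ofRing R).det X ^ (n - k) * (ofRing R).compound k X I J :=
  ofRing_jacobi_finset X I.1 J.1 I.2 J.2

end SemiringSymmetry

/-! ### Monomials of `det(X)^m · X^{∧k}_{I,J}` -/

/-- The exponent vector of the monomial `∏_{i ∈ I} x_{i,σ(i)}`. -/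
noncomputable def graphExponent {n : ℕ} {I J : Finset (Fin n)} (σ : I ≃ J) :
    Fin n × Fin n →₀ ℕ :=
  ∑ i : I, Finsupp.single ((i : Fin n), (σ i : Fin n)) 1

/-- The exponent vector of the monomial `∏_i x_{i,ρ(i)}`. -/
noncomputable def permExponent {n : ℕ} (ρ : Equiv.Perm (Fin n)) : Fin n × Fin n →₀ ℕ :=
  ∑ i, Finsupp.single (i, ρ i) 1

theorem graphExponent_apply {n : ℕ} {I J : Finset (Fin n)} (σ : I ≃ J) (x y : Fin n) :
    graphExponent σ (x, y) = if ∃ h : x ∈ I, (σ ⟨x, h⟩ : Fin n) = y then 1 else 0 := by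
  rw [graphExponent, Finsupp.finsetSum_apply]
  by_cases hx : x ∈ I
  · rw [Finset.sum_eq_single ⟨x, hx⟩]
    · simp [Finsupp.single_apply, hx]
    · intro i _ hi
      have : (i : Fin n) ≠ x := fun h => hi (Subtype.ext h)
      simp [this]
    · simp
  · rw [Finset.sum_eq_zero]
    · simp [hx]
    · intro i _
      have : (i : Fin n) ≠ x := fun h => hx (h ▸ i.2)
      simp [this]

theorem permExponent_apply {n : ℕ} (ρ : Equiv.Perm (Fin n)) (x y : Fin n) :
    permExponent ρ (x, y) = if ρ x = y then 1 else 0 := by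
  rw [permExponent, Finsupp.finsetSum_apply, Finset.sum_eq_single x]
  · simp [Finsupp.single_apply]
  · intro i _ hi
    simp [hi]
  · simp

theorem graphExponent_injective {n : ℕ} {I J : Finset (Fin n)} :
    Function.Injective (graphExponent : (I ≃ J) → Fin n × Fin n →₀ ℕ) := by
  intro σ σ' h
  ext i
  have := DFunLike.congr_fun h ((i : Fin n), (σ i : Fin n))
  rw [graphExponent_apply, graphExponent_apply] at this
  simp only [Subtype.coe_eta, Finset.coe_mem, exists_const, if_true] at this
  split_ifs at this with h2
  rw [h2]

open SemiringSymmetry in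
/-- If the graph of `τ` is covered by those of `ρ` and `σ`, the remaining part of the two graphs is
again the graph of a bijection, `ρτ⁻¹σ`. -/
theorem exists_graphExponent_switch {n : ℕ} {I J : Finset (Fin n)} (ρ τ : Equiv.Perm (Fin n))
    (σ : I ≃ J) (h : ∀ x, τ x = ρ x ∨ ∃ hx : x ∈ I, (σ ⟨x, hx⟩ : Fin n) = τ x) :
    ∃ σ' : I ≃ J, permExponent τ + graphExponent σ' = permExponent ρ + graphExponent σ ∧
      (Equiv.Perm.sign τ : ℤ) * (ofRing ℤ).sign σ' =
        (Equiv.Perm.sign ρ : ℤ) * (ofRing ℤ).sign σ := by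
  let θ : Equiv.Perm (Fin n) := ρ * τ⁻¹
  -- Outside `J` the permutation `τ` can only follow `ρ`, so that `ρτ⁻¹` restricts to `J`.
  have hθ : ∀ y, y ∉ J → θ y = y := by
    intro y hy
    rcases h (τ⁻¹ y) with h' | ⟨hx, h'⟩
    · simpa [θ] using h'.symm
    · have := (σ ⟨τ⁻¹ y, hx⟩).2
      rw [h'] at this
      exact absurd (by simpa using this) hy
  have hθJ : ∀ y, y ∈ J ↔ θ y ∈ J := by
    intro y
    by_cases hy : θ y ∈ J
    · refine ⟨fun _ => hy, fun _ => ?_⟩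
      by_contra h2
      exact h2 (hθ y h2 ▸ hy)
    · refine ⟨fun h2 => ?_, fun h2 => absurd h2 hy⟩
      exact absurd ((θ.injective (hθ _ hy)).symm ▸ h2 : θ y ∈ J) hy
  let θJ : Equiv.Perm J := θ.subtypePerm fun y => (hθJ y).symm
  have hsgn : Equiv.Perm.sign θJ = Equiv.Perm.sign θ := by
    convert! Equiv.Perm.sign_subtypePerm θ (fun y => (hθJ y).symm) fun y hy => by
      by_contra h2
      exact hy (hθ y h2)
  refine ⟨σ.trans θJ, ?_, ?_⟩
  · -- In each row of `I`, the new bijection uses whichever of `ρ` and `σ` is left over by `τ`.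
    have h1 : ∀ x (hx : x ∈ I), τ x = ρ x → θ (σ ⟨x, hx⟩) = σ ⟨x, hx⟩ := by
      intro x hx hτ
      rcases h (τ⁻¹ (σ ⟨x, hx⟩)) with h' | ⟨hz, h'⟩
      · simpa [θ] using h'.symm
      · have h3 : σ ⟨_, hz⟩ = σ ⟨x, hx⟩ := Subtype.ext (by simpa using h')
        have h4 : τ⁻¹ (σ ⟨x, hx⟩) = x := congrArg Subtype.val (σ.injective h3)
        have h5 : τ x = σ ⟨x, hx⟩ := (Equiv.Perm.inv_eq_iff_eq.1 h4).symm
        simp only [θ, Equiv.Perm.mul_apply, h4]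
        rw [← hτ, h5]
    have h2 : ∀ x (hx : x ∈ I), (σ ⟨x, hx⟩ : Fin n) = τ x → θ (σ ⟨x, hx⟩) = ρ x := by
      intro x hx hτ
      simp [θ, hτ]
    ext ⟨x, y⟩
    simp only [Finsupp.add_apply, permExponent_apply, graphExponent_apply, Equiv.trans_apply,
      θJ, Equiv.Perm.subtypePerm_apply]
    by_cases hx : x ∈ I
    · simp only [hx, exists_true_left]
      rcases h x with h' | ⟨_, h'⟩
      · rw [h1 x hx h', h']
      · rw [h2 x hx h', ← h', add_comm]
    · rcases h x with h' | ⟨h', _⟩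
      · simp [hx, h']
      · exact absurd h' hx
  · have hcard : Fintype.card I = Fintype.card J := Fintype.card_congr σ
    let f : J ≃o I := (Fintype.orderIsoFinOfCardEq J hcard.symm).symm.trans
      (Fintype.orderIsoFinOfCardEq I rfl)
    rw [ofRing_sign _ f, ofRing_sign _ f]
    have h3 : (σ.trans θJ).trans f.toEquiv =
        (f.symm.toEquiv.trans (θJ.trans f.toEquiv)) * (σ.trans f.toEquiv) := by
      ext x
      simp
    have h4 : Equiv.Perm.sign (f.symm.toEquiv.trans (θJ.trans f.toEquiv)) =
        Equiv.Perm.sign θJ := Equiv.Perm.sign_symm_trans_trans θJ f.toEquiv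
    rw [h3, Equiv.Perm.sign_mul, h4, hsgn]
    simp only [θ, Equiv.Perm.sign_mul, Equiv.Perm.sign_inv, Int.cast_id, Units.val_mul]
    have h5 : (Equiv.Perm.sign τ : ℤ) * (Equiv.Perm.sign τ : ℤ) = 1 := by
      rw [← Units.val_mul, Int.units_mul_self, Units.val_one]
    linear_combination ((Equiv.Perm.sign ρ : ℤ) *
      (Equiv.Perm.sign (σ.trans f.toEquiv) : ℤ)) * h5

namespace SemiringSymmetry

open MvPolynomial

theorem ofRing_sign_mvPolynomial {ι α β : Type*} [Fintype α] [LinearOrder α] [LinearOrder β]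
    (σ : α ≃ β) :
    (ofRing (MvPolynomial ι ℤ)).sign σ = C ((ofRing ℤ).sign σ) := by
  simp [sign, ofRing]

theorem prod_X_eq_monomial {ι κ : Type*} (s : Finset κ) (g : κ → ι) :
    ∏ i ∈ s, (X (g i) : MvPolynomial ι ℤ) = monomial (∑ i ∈ s, Finsupp.single (g i) 1) 1 := by
  classical
  induction s using Finset.induction_on with
  | empty => simp
  | insert a s ha ih =>
    rw [Finset.prod_insert ha, Finset.sum_insert ha, ih, X, monomial_mul, one_mul]

theorem compound_mvPolynomialX {n k : ℕ} (I J : KSubset (Fin n) k) :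
    (ofRing _).compound k (Matrix.mvPolynomialX (Fin n) (Fin n) ℤ) I J =
      ∑ σ : I.1 ≃ J.1, monomial (graphExponent σ) ((ofRing ℤ).sign σ) := by
  refine Finset.sum_congr rfl fun σ _ => ?_
  simp only [Matrix.mvPolynomialX_apply]
  rw [ofRing_sign_mvPolynomial, prod_X_eq_monomial, C_mul_monomial, mul_one]
  rfl

theorem det_mvPolynomialX {n : ℕ} :
    (ofRing _).det (Matrix.mvPolynomialX (Fin n) (Fin n) ℤ) =
      ∑ τ : Equiv.Perm (Fin n), monomial (permExponent τ) (Equiv.Perm.sign τ : ℤ) := by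
  rw [det]
  refine Finset.sum_congr rfl fun σ _ => ?_
  simp only [Matrix.mvPolynomialX_apply]
  rw [ofRing_sign_mvPolynomial, prod_X_eq_monomial, C_mul_monomial, mul_one, ofRing_sign_fin]
  rfl

/-- In `det(X)^m · X^{∧k}_{I,J}`, the terms contributing to the monomial
`x_ρ^m · ∏_{i ∈ I} x_{i,σ(i)}` all have the same sign, so that they do not cancel. -/
theorem one_le_coeff_det_pow_mul_compound {n k : ℕ} (I J : KSubset (Fin n) k)
    (ρ : Equiv.Perm (Fin n)) (m : ℕ) (σ : I.1 ≃ J.1) :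
    1 ≤ (Equiv.Perm.sign ρ : ℤ) ^ m * (ofRing ℤ).sign σ *
      coeff (m • permExponent ρ + graphExponent σ)
        ((ofRing _).det (Matrix.mvPolynomialX (Fin n) (Fin n) ℤ) ^ m *
          (ofRing _).compound k (Matrix.mvPolynomialX (Fin n) (Fin n) ℤ) I J) := by
  induction m generalizing σ with
  | zero =>
    rw [pow_zero, one_mul, pow_zero, one_mul, zero_smul, zero_add, compound_mvPolynomialX,
      coeff_sum, Finset.sum_eq_single σ]
    · rw [coeff_monomial, if_pos rfl, sign]
      change 1 ≤ (-1 : ℤ) ^ _ * (-1) ^ _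
      rw [← mul_pow]
      simp
    · intro σ' _ h
      rw [coeff_monomial, if_neg fun h' => h (graphExponent_injective h')]
    · simp
  | succ m ih =>
    set P := (ofRing _).det (Matrix.mvPolynomialX (Fin n) (Fin n) ℤ) ^ m *
      (ofRing _).compound k (Matrix.mvPolynomialX (Fin n) (Fin n) ℤ) I J with hP
    have hsplit : (ofRing _).det (Matrix.mvPolynomialX (Fin n) (Fin n) ℤ) ^ (m + 1) *
        (ofRing _).compound k (Matrix.mvPolynomialX (Fin n) (Fin n) ℤ) I J =
        ∑ τ : Equiv.Perm (Fin n), monomial (permExponent τ) (Equiv.Perm.sign τ : ℤ) * P := by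
      rw [← Finset.sum_mul, ← det_mvPolynomialX, hP]
      ring
    have hsq : ∀ τ : Equiv.Perm (Fin n),
        (Equiv.Perm.sign τ : ℤ) * (Equiv.Perm.sign τ : ℤ) = 1 := fun τ => by
      rw [← Units.val_mul, Int.units_mul_self, Units.val_one]
    rw [hsplit, coeff_sum, Finset.mul_sum]
    have hterm : ∀ τ : Equiv.Perm (Fin n),
        (τ = ρ → permExponent τ ≤ (m + 1) • permExponent ρ + graphExponent σ) ∧
        (permExponent τ ≤ (m + 1) • permExponent ρ + graphExponent σ →
        1 ≤ (Equiv.Perm.sign ρ : ℤ) ^ (m + 1) * (ofRing ℤ).sign σ * ((Equiv.Perm.sign τ : ℤ) *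
          coeff ((m + 1) • permExponent ρ + graphExponent σ - permExponent τ) P)) := by
      intro τ
      constructor
      · rintro rfl
        rw [succ_nsmul, add_right_comm]
        exact le_add_self
      · intro hle
        obtain ⟨σ', hσ', hs⟩ := exists_graphExponent_switch ρ τ σ fun x => by
          have := hle (x, τ x)
          by_contra hcon
          push Not at hcon
          rw [Finsupp.add_apply, Finsupp.smul_apply, permExponent_apply, permExponent_apply,
            graphExponent_apply, if_pos rfl, if_neg hcon.1.symm,
            if_neg fun h => hcon.2 h.1 h.2] at this
          simp at this
        have hexp : (m + 1) • permExponent ρ + graphExponent σ - permExponent τ =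
            m • permExponent ρ + graphExponent σ' := by
          rw [succ_nsmul, add_assoc, ← hσ', add_left_comm, add_tsub_cancel_left]
        refine (ih σ').trans_eq ?_
        rw [hexp]
        linear_combination (-(Equiv.Perm.sign ρ : ℤ) ^ m * (ofRing ℤ).sign σ' *
          coeff (m • permExponent ρ + graphExponent σ') P) * (hsq τ) +
          ((Equiv.Perm.sign ρ : ℤ) ^ m * (Equiv.Perm.sign τ : ℤ) *
          coeff (m • permExponent ρ + graphExponent σ') P) * hs
    -- All terms are nonnegative, and the one of `τ = ρ` is at least `1`.
    refine le_trans ?_ (Finset.single_le_sum (f := fun τ => _) (fun τ _ => ?_)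
      (Finset.mem_univ ρ))
    · rw [coeff_monomial_mul', if_pos ((hterm ρ).1 rfl)]
      exact (hterm ρ).2 ((hterm ρ).1 rfl)
    · rw [coeff_monomial_mul']
      split_ifs with hle
      · exact zero_le_one.trans ((hterm τ).2 hle)
      · simp

end SemiringSymmetry

/-! ### Evaluating integer polynomials in a semiring with symmetry -/

namespace SemiringSymmetry

variable {S : Type*} [CommSemiring S] (τ : SemiringSymmetry S)

variable {τ} in
theorem CircGE.refl (a : S) : τ.CircGE a a :=
  ⟨0, ⟨0, by simp [circ, τ.neg_zero]⟩, by simp⟩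

variable {τ} in
theorem CircGE.add {a b c d : S} (h : τ.CircGE a b) (h' : τ.CircGE c d) :
    τ.CircGE (a + c) (b + d) := by
  obtain ⟨_, ⟨u, rfl⟩, rfl⟩ := h
  obtain ⟨_, ⟨v, rfl⟩, rfl⟩ := h'
  refine ⟨_, ⟨u + v, rfl⟩, ?_⟩
  simp only [circ, τ.neg_add]
  ring

variable {τ} in
theorem CircGE.trans {a b c : S} (h : τ.CircGE a b) (h' : τ.CircGE b c) : τ.CircGE a c := by
  obtain ⟨_, ⟨u, rfl⟩, rfl⟩ := h
  obtain ⟨_, ⟨v, rfl⟩, rfl⟩ := h'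
  refine ⟨_, ⟨u + v, rfl⟩, ?_⟩
  simp only [circ, τ.neg_add]
  ring

variable {τ} in
theorem CircGE.mul_left (c : S) {a b : S} (h : τ.CircGE a b) : τ.CircGE (c * a) (c * b) := by
  obtain ⟨_, ⟨u, rfl⟩, rfl⟩ := h
  refine ⟨_, ⟨c * u, rfl⟩, ?_⟩
  simp only [circ, τ.neg_mul_right]
  ring

variable {τ} in
theorem CircGE.mul {a b c d : S} (h : τ.CircGE a b) (h' : τ.CircGE c d) :
    τ.CircGE (a * c) (b * d) := by
  refine (h'.mul_left a).trans ?_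
  rw [mul_comm a, mul_comm b]
  exact h.mul_left d

variable {τ} in
theorem CircGE.sum {ι : Type*} (s : Finset ι) {f g : ι → S} (h : ∀ i ∈ s, τ.CircGE (f i) (g i)) :
    τ.CircGE (∑ i ∈ s, f i) (∑ i ∈ s, g i) := by
  classical
  induction s using Finset.induction_on with
  | empty => simpa using CircGE.refl _
  | insert a s ha ih =>
    rw [Finset.sum_insert ha, Finset.sum_insert ha]
    exact (h a (Finset.mem_insert_self _ _)).add
      (ih fun i hi => h i (Finset.mem_insert_of_mem hi))

variable {τ} in
theorem CircGE.natLE {a b : S} (h : τ.CircGE b a) : NatLE a b :=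
  h.imp fun _ h => h.2

/-- The image of an integer: `c` times `1` if `c ≥ 0`, and `|c|` times `⊖1` otherwise. -/
def ofInt (c : ℤ) : S := (c.toNat : S) + τ.neg ((-c).toNat : S)

theorem ofInt_zero : τ.ofInt 0 = 0 := by simp [ofInt, τ.neg_zero]

theorem ofInt_one : τ.ofInt 1 = 1 := by simp [ofInt, τ.neg_zero]

theorem ofInt_neg (c : ℤ) : τ.ofInt (-c) = τ.neg (τ.ofInt c) := by
  rw [ofInt, ofInt, τ.neg_add, τ.neg_neg, _root_.neg_neg, add_comm]

theorem ofInt_natCast (c : ℕ) : τ.ofInt c = c := by simp [ofInt, τ.neg_zero]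

/-- Cancellation among integers becomes a term of `S°`. -/
theorem circGE_ofInt_add (a b : ℤ) : τ.CircGE (τ.ofInt a + τ.ofInt b) (τ.ofInt (a + b)) := by
  obtain ⟨u, hu, hu'⟩ : ∃ u : ℕ, a.toNat + b.toNat = (a + b).toNat + u ∧
      (-a).toNat + (-b).toNat = (-(a + b)).toNat + u :=
    ⟨a.toNat + b.toNat - (a + b).toNat, by omega, by omega⟩
  refine ⟨_, ⟨u, rfl⟩, ?_⟩
  have hu := congrArg (Nat.cast : ℕ → S) hu
  have hu' := congrArg (fun x : ℕ => τ.neg (x : S)) hu'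
  simp only [Nat.cast_add, τ.neg_add] at hu hu'
  calc τ.ofInt a + τ.ofInt b = ((a.toNat : S) + b.toNat) +
        (τ.neg ((-a).toNat : S) + τ.neg ((-b).toNat : S)) := by rw [ofInt, ofInt]; ring
    _ = _ := by rw [hu, hu', ofInt, circ]; ring

theorem ofInt_mul (a b : ℤ) : τ.ofInt (a * b) = τ.ofInt a * τ.ofInt b := by
  have h (m : ℕ) (b : ℤ) : τ.ofInt (m * b) = τ.ofInt m * τ.ofInt b := by
    obtain ⟨k, rfl | rfl⟩ := b.eq_nat_or_neg
    · rw [← Nat.cast_mul, ofInt_natCast, ofInt_natCast, ofInt_natCast, Nat.cast_mul]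
    · rw [mul_neg, ofInt_neg, ofInt_neg, ← Nat.cast_mul, ofInt_natCast, ofInt_natCast,
        ofInt_natCast, Nat.cast_mul, τ.neg_mul_right]
  obtain ⟨m, rfl | rfl⟩ := a.eq_nat_or_neg
  · exact h m b
  · rw [neg_mul, ofInt_neg, h, ofInt_neg, τ.neg_mul_left]

theorem ofInt_pow (c : ℤ) (m : ℕ) : τ.ofInt (c ^ m) = τ.ofInt c ^ m := by
  induction m with
  | zero => rw [pow_zero, pow_zero, ofInt_one]
  | succ m ih => rw [pow_succ, pow_succ, ofInt_mul, ih]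

theorem ofInt_ofRing_sign {α β : Type*} [Fintype α] [LinearOrder α] [LinearOrder β] (σ : α ≃ β) :
    τ.ofInt ((ofRing ℤ).sign σ) = τ.sign σ := by
  refine (τ.ofInt_pow (-1) _).trans ?_
  rw [ofInt_neg, ofInt_one, sign]

/-- An integer of the same sign as `ε = ±1` dominates it. -/
theorem natLE_ofInt {ε c : ℤ} (hε : ε = 1 ∨ ε = -1) (h : 1 ≤ ε * c) :
    NatLE (τ.ofInt ε) (τ.ofInt c) := by
  have key (d : ℤ) (hd : 1 ≤ d) : τ.ofInt d = 1 + τ.ofInt (d - 1) := by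
    lift d to ℕ using by omega
    obtain ⟨e, rfl⟩ : ∃ e, d = e + 1 := ⟨d - 1, by omega⟩
    rw [ofInt_natCast, Nat.cast_add, Nat.cast_add, Nat.cast_one, Nat.cast_one,
      add_sub_cancel_right, ofInt_natCast, add_comm]
  rcases hε with rfl | rfl
  · exact ⟨_, by rw [key c (by simpa using h), ofInt_one]⟩
  · refine ⟨τ.neg (τ.ofInt (-c - 1)), ?_⟩
    rw [ofInt_neg, ofInt_one, ← τ.neg_add, ← key (-c) (by simpa using h), ← ofInt_neg,
      _root_.neg_neg]

section Eval

open MvPolynomial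

variable {ι : Type*}

/-- The value at `a` of the monomial with exponent vector `e`. -/
def evalMonomial (a : ι → S) (e : ι →₀ ℕ) : S := e.prod fun i k => a i ^ k

theorem evalMonomial_add (a : ι → S) (e e' : ι →₀ ℕ) :
    evalMonomial a (e + e') = evalMonomial a e * evalMonomial a e' := by
  classical
  exact Finsupp.prod_add_index' (fun _ => pow_zero _) fun _ _ _ => pow_add _ _ _

theorem evalMonomial_zero (a : ι → S) : evalMonomial a 0 = 1 := Finsupp.prod_zero_index

theorem evalMonomial_sum_single {κ : Type*} (a : ι → S) (s : Finset κ) (g : κ → ι) :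
    evalMonomial a (∑ i ∈ s, Finsupp.single (g i) 1) = ∏ i ∈ s, a (g i) := by
  classical
  induction s using Finset.induction_on with
  | empty => simp [evalMonomial_zero]
  | insert b s hb ih =>
    rw [Finset.sum_insert hb, Finset.prod_insert hb, evalMonomial_add, ih, evalMonomial,
      Finsupp.prod_single_index (by simp), pow_one]

theorem evalMonomial_nsmul (a : ι → S) (m : ℕ) (e : ι →₀ ℕ) :
    evalMonomial a (m • e) = evalMonomial a e ^ m := by
  induction m with
  | zero => simp [evalMonomial_zero]
  | succ m ih => rw [succ_nsmul, evalMonomial_add, ih, pow_succ]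

/-- The value at `a` of the reduced form of an integer polynomial: each monomial occurs with its
integer coefficient, interpreted in `S` by `ofInt`. It is not a ring morphism, since
cancellation does not take place in `S`. -/
def evalReduced (a : ι → S) (p : MvPolynomial ι ℤ) : S :=
  ∑ e ∈ p.support, τ.ofInt (p.coeff e) * evalMonomial a e

theorem evalReduced_eq_sum (a : ι → S) (p : MvPolynomial ι ℤ) (s : Finset (ι →₀ ℕ))
    (h : p.support ⊆ s) :
    τ.evalReduced a p = ∑ e ∈ s, τ.ofInt (p.coeff e) * evalMonomial a e :=
  Finset.sum_subset h fun e _ he => by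
    rw [notMem_support_iff.1 he, ofInt_zero, zero_mul]

theorem evalReduced_monomial (a : ι → S) (e : ι →₀ ℕ) (c : ℤ) :
    τ.evalReduced a (monomial e c) = τ.ofInt c * evalMonomial a e := by
  classical
  rw [τ.evalReduced_eq_sum a _ {e} support_monomial_subset, Finset.sum_singleton, coeff_monomial,
    if_pos rfl]

theorem circGE_evalReduced_add (a : ι → S) (p q : MvPolynomial ι ℤ) :
    τ.CircGE (τ.evalReduced a p + τ.evalReduced a q) (τ.evalReduced a (p + q)) := by
  classical
  rw [τ.evalReduced_eq_sum a p (p.support ∪ q.support) Finset.subset_union_left,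
    τ.evalReduced_eq_sum a q (p.support ∪ q.support) Finset.subset_union_right,
    τ.evalReduced_eq_sum a (p + q) (p.support ∪ q.support) support_add,
    ← Finset.sum_add_distrib]
  refine CircGE.sum _ fun e _ => ?_
  rw [coeff_add, ← add_mul]
  exact (τ.circGE_ofInt_add _ _).mul (CircGE.refl _)

theorem circGE_evalReduced_sum (a : ι → S) {κ : Type*} (s : Finset κ) (p : κ → MvPolynomial ι ℤ) :
    τ.CircGE (∑ i ∈ s, τ.evalReduced a (p i)) (τ.evalReduced a (∑ i ∈ s, p i)) := by
  classical
  induction s using Finset.induction_on with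
  | empty => simpa [evalReduced] using CircGE.refl _
  | insert b s hb ih =>
    rw [Finset.sum_insert hb, Finset.sum_insert hb]
    exact ((CircGE.refl _).add ih).trans (τ.circGE_evalReduced_add a _ _)

theorem circGE_evalReduced_mul (a : ι → S) (p q : MvPolynomial ι ℤ) :
    τ.CircGE (τ.evalReduced a p * τ.evalReduced a q) (τ.evalReduced a (p * q)) := by
  have h1 : τ.evalReduced a p * τ.evalReduced a q = ∑ e ∈ p.support, ∑ e' ∈ q.support,
      τ.evalReduced a (monomial (e + e') (p.coeff e * q.coeff e')) := by
    rw [evalReduced, evalReduced, Finset.sum_mul_sum]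
    refine Finset.sum_congr rfl fun e _ => Finset.sum_congr rfl fun e' _ => ?_
    rw [evalReduced_monomial, ofInt_mul, evalMonomial_add]
    ring
  have h2 : p * q = ∑ e ∈ p.support, ∑ e' ∈ q.support,
      monomial (e + e') (p.coeff e * q.coeff e') := by
    conv_lhs => rw [p.as_sum, q.as_sum, Finset.sum_mul_sum]
    simp only [monomial_mul]
  rw [h1, h2]
  exact (CircGE.sum _ fun e _ => τ.circGE_evalReduced_sum a _ _).trans
    (τ.circGE_evalReduced_sum a _ _)

theorem evalReduced_C (a : ι → S) (c : ℤ) : τ.evalReduced a (C c) = τ.ofInt c := by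
  rw [C_apply, evalReduced_monomial, evalMonomial_zero, mul_one]

theorem evalReduced_X (a : ι → S) (i : ι) : τ.evalReduced a (X i) = a i := by
  rw [X, evalReduced_monomial, ofInt_one, one_mul]
  simp [evalMonomial]

/-- Lax evaluation of a polynomial: `b` exceeds the value of the reduced form of `p` by an element
of `S°`, which accounts for the cancellations. -/
def Dominates (a : ι → S) (b : S) (p : MvPolynomial ι ℤ) : Prop :=
  τ.CircGE b (τ.evalReduced a p)

variable {τ} {a : ι → S}

theorem Dominates.one : τ.Dominates a 1 1 := by
  rw [Dominates, ← C_1, evalReduced_C, ofInt_one]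
  exact CircGE.refl _

theorem Dominates.mul {b c : S} {p q : MvPolynomial ι ℤ} (h : τ.Dominates a b p)
    (h' : τ.Dominates a c q) : τ.Dominates a (b * c) (p * q) :=
  (CircGE.mul h h').trans (τ.circGE_evalReduced_mul a _ _)

theorem Dominates.pow {b : S} {p : MvPolynomial ι ℤ} (h : τ.Dominates a b p) (m : ℕ) :
    τ.Dominates a (b ^ m) (p ^ m) := by
  induction m with
  | zero => simpa using Dominates.one
  | succ m ih => simpa only [pow_succ] using ih.mul h

theorem Dominates.prod {κ : Type*} (s : Finset κ) {f : κ → S} {p : κ → MvPolynomial ι ℤ}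
    (h : ∀ i ∈ s, τ.Dominates a (f i) (p i)) :
    τ.Dominates a (∏ i ∈ s, f i) (∏ i ∈ s, p i) := by
  classical
  induction s using Finset.induction_on with
  | empty => simpa using Dominates.one
  | insert b s hb ih =>
    rw [Finset.prod_insert hb, Finset.prod_insert hb]
    exact (h b (Finset.mem_insert_self _ _)).mul
      (ih fun i hi => h i (Finset.mem_insert_of_mem hi))

theorem Dominates.sum {κ : Type*} (s : Finset κ) {f : κ → S} {p : κ → MvPolynomial ι ℤ}
    (h : ∀ i ∈ s, τ.Dominates a (f i) (p i)) :
    τ.Dominates a (∑ i ∈ s, f i) (∑ i ∈ s, p i) :=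
  (CircGE.sum s h).trans (τ.circGE_evalReduced_sum a _ _)

/-- Determinantal expressions over `S` dominate the reduced forms of the corresponding integer
polynomials: this is how identities over `ℤ` transfer to `S`. -/
theorem Dominates.det {α β : Type*} [Fintype α] [Fintype β] [LinearOrder α] [LinearOrder β]
    {A : Matrix α β S} {P : Matrix α β (MvPolynomial ι ℤ)}
    (h : ∀ i j, τ.Dominates a (A i j) (P i j)) :
    τ.Dominates a (τ.det A) ((ofRing _).det P) := by
  refine Dominates.sum _ fun σ _ => Dominates.mul ?_ (Dominates.prod _ fun i _ => h i _)
  rw [Dominates, ofRing_sign_mvPolynomial, evalReduced_C, ofInt_ofRing_sign]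
  exact CircGE.refl _

theorem Dominates.mvPolynomialX {n : ℕ} (A : Matrix (Fin n) (Fin n) S) (i j : Fin n) :
    τ.Dominates (fun x : Fin n × Fin n => A x.1 x.2) (A i j) (Matrix.mvPolynomialX _ _ ℤ i j) := by
  rw [Dominates, Matrix.mvPolynomialX_apply, evalReduced_X]
  exact CircGE.refl _

end Eval

end SemiringSymmetry

/-! ### The modulus and the natural order -/

theorem NatLE.trans {S : Type*} [Semiring S] {a b c : S} (h : NatLE a b) (h' : NatLE b c) :
    NatLE a c := by
  obtain ⟨u, rfl⟩ := h
  obtain ⟨v, rfl⟩ := h'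
  exact ⟨u + v, add_assoc _ _ _⟩

theorem NatLE.mul_right {S : Type*} [Semiring S] {a b : S} (h : NatLE a b) (c : S) :
    NatLE (a * c) (b * c) := by
  obtain ⟨u, rfl⟩ := h
  exact ⟨u * c, add_mul _ _ _⟩

theorem NatLE.sum {S ι : Type*} [Semiring S] (s : Finset ι) {f g : ι → S}
    (h : ∀ i ∈ s, NatLE (f i) (g i)) : NatLE (∑ i ∈ s, f i) (∑ i ∈ s, g i) := by
  choose! u hu using h
  exact ⟨∑ i ∈ s, u i, by rw [← Finset.sum_add_distrib]; exact Finset.sum_congr rfl hu⟩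

theorem natLE_sum_of_subset {S ι : Type*} [Semiring S] {s t : Finset ι} (h : s ⊆ t) (f : ι → S) :
    NatLE (∑ i ∈ s, f i) (∑ i ∈ t, f i) := by
  classical
  exact ⟨∑ i ∈ t \ s, f i, by rw [add_comm, Finset.sum_sdiff h]⟩

/-- In a totally ordered idempotent semiring, a nonempty sum is its largest term. -/
theorem IsTotallyOrderedIdempotentSemifield.exists_sum_eq {M ι : Type*} [Semiring M]
    (hM : IsTotallyOrderedIdempotentSemifield M) {s : Finset ι} (hs : s.Nonempty) (f : ι → M) :
    ∃ i ∈ s, ∑ j ∈ s, f j = f i := by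
  induction hs using Finset.Nonempty.cons_induction with
  | singleton a => exact ⟨a, Finset.mem_singleton_self a, Finset.sum_singleton _ _⟩
  | cons a s ha hs ih =>
    obtain ⟨i, hi, h⟩ := ih
    rw [Finset.sum_cons, h]
    rcases hM.total (f a) (f i) with ⟨c, hc⟩ | ⟨c, hc⟩
    · exact ⟨i, Finset.mem_cons_of_mem hi, by rw [hc, ← add_assoc, hM.add_self]⟩
    · exact ⟨a, Finset.mem_cons_self _ _, by
        rw [hc, add_comm, ← add_assoc, hM.add_self]⟩

namespace IsExtendedTropical

variable {S M : Type*} [CommSemiring S] [Semiring M] {τ : SemiringSymmetry S} {μ : S →+* M}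

/-- An invertible determinant equals one of its terms: a term of maximal modulus is `≼` the
determinant and has the same modulus. -/
theorem exists_det_eq (hT : IsExtendedTropical τ μ) {n : ℕ} {A : Matrix (Fin n) (Fin n) S}
    (hA : τ.Nonsingular A) :
    ∃ ρ : Equiv.Perm (Fin n), τ.det A = τ.sign ρ * ∏ i, A i (ρ i) := by
  obtain ⟨ρ, hρ, h⟩ := hT.semifield.exists_sum_eq (Finset.univ_nonempty (α := Fin n ≃ Fin n))
    fun σ => μ (τ.sign σ * ∏ i, A i (σ i))
  refine ⟨ρ, (hT.eq_of_le _ _ ?_ ?_ (Or.inl hA)).symm⟩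
  · have := natLE_sum_of_subset (Finset.subset_univ {ρ})
      fun σ : Fin n ≃ Fin n => τ.sign σ * ∏ i, A i (σ i)
    rwa [Finset.sum_singleton] at this
  · rw [← h, ← map_sum]
    rfl

open SemiringSymmetry MvPolynomial in
/-- Reducing the polynomial `det(X)^m · X^{∧k}_{I,J}` does not change its value at a nonsingular
matrix: both values are bounded below by the part of the product in which every factor `det` is
represented by a single maximal term, and this part is already the whole product. -/
theorem det_pow_mul_compound_eq_evalReduced (hT : IsExtendedTropical τ μ) {n k : ℕ}
    {A : Matrix (Fin n) (Fin n) S} (hA : τ.Nonsingular A) (m : ℕ) (I J : KSubset (Fin n) k) :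
    τ.det A ^ m * τ.compound k A I J =
      τ.evalReduced (fun x : Fin n × Fin n => A x.1 x.2)
        ((ofRing _).det (Matrix.mvPolynomialX (Fin n) (Fin n) ℤ) ^ m *
          (ofRing _).compound k (Matrix.mvPolynomialX (Fin n) (Fin n) ℤ) I J) := by
  classical
  set a : Fin n × Fin n → S := fun x => A x.1 x.2
  set Q := (ofRing _).det (Matrix.mvPolynomialX (Fin n) (Fin n) ℤ) ^ m *
    (ofRing _).compound k (Matrix.mvPolynomialX (Fin n) (Fin n) ℤ) I J
  have hX := Dominates.mvPolynomialX (τ := τ) A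
  refine hT.naturallyOrdered _ _ ?_ (CircGE.natLE
    (((Dominates.det hX).pow m).mul (Dominates.det fun s t => hX s t)))
  obtain ⟨ρ, hρ⟩ := hT.exists_det_eq hA
  let e (σ : I.1 ≃ J.1) : Fin n × Fin n →₀ ℕ := m • permExponent ρ + graphExponent σ
  let ε (σ : I.1 ≃ J.1) : ℤ := (Equiv.Perm.sign ρ : ℤ) ^ m * (ofRing ℤ).sign σ
  have he : Function.Injective e := fun σ σ' h => graphExponent_injective (add_left_cancel h)
  have hε (σ : I.1 ≃ J.1) : ε σ = 1 ∨ ε σ = -1 := by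
    refine Int.isUnit_iff.1 (((Units.isUnit _).pow m).mul ?_)
    exact (isUnit_one.neg.pow _ : IsUnit ((-1 : ℤ) ^ _))
  have hexpand : τ.det A ^ m * τ.compound k A I J =
      ∑ σ, τ.ofInt (ε σ) * evalMonomial a (e σ) := by
    have hc : τ.compound k A I J =
        ∑ σ : I.1 ≃ J.1, τ.ofInt ((ofRing ℤ).sign σ) * evalMonomial a (graphExponent σ) := by
      refine Finset.sum_congr rfl fun σ _ => ?_
      rw [ofInt_ofRing_sign, graphExponent, evalMonomial_sum_single]
    have hd : τ.det A =
        τ.ofInt (Equiv.Perm.sign ρ : ℤ) * evalMonomial a (permExponent ρ) := by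
      have := ofRing_sign_fin (R := ℤ) ρ
      rw [Int.cast_id] at this
      rw [hρ, ← this, ofInt_ofRing_sign, permExponent, evalMonomial_sum_single]
    rw [hc, Finset.mul_sum]
    refine Finset.sum_congr rfl fun σ _ => ?_
    simp only [ε, e]
    rw [ofInt_mul, ofInt_pow, evalMonomial_add, evalMonomial_nsmul, hd]
    ring
  -- The monomials of `hexpand` survive in `Q` with a nonzero coefficient of the same sign.
  have hcoeff (σ : I.1 ≃ J.1) : 1 ≤ ε σ * coeff (e σ) Q :=
    one_le_coeff_det_pow_mul_compound I J ρ m σ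
  have hsub : Finset.univ.image e ⊆ Q.support := fun x hx => by
    obtain ⟨σ, -, rfl⟩ := Finset.mem_image.1 hx
    rw [mem_support_iff]
    intro h0
    have := hcoeff σ
    rw [h0, mul_zero] at this
    exact absurd this (by norm_num)
  rw [hexpand]
  refine (NatLE.sum _ fun σ _ => (τ.natLE_ofInt (hε σ) (hcoeff σ)).mul_right _).trans ?_
  rw [← Finset.sum_image (f := fun x => τ.ofInt (coeff x Q) * evalMonomial a x)
    fun _ _ _ _ h => he h]
  exact natLE_sum_of_subset hsub _

end IsExtendedTropical

theorem SemiringSymmetry.det_const_mul {S : Type*} [CommSemiring S] (τ : SemiringSymmetry S)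
    {α β : Type*} [Fintype α] [Fintype β] [LinearOrder α] [LinearOrder β] (c : S)
    (A : Matrix α β S) :
    τ.det (fun i j => c * A i j) = c ^ Fintype.card α * τ.det A := by
  unfold SemiringSymmetry.det
  rw [Finset.mul_sum]
  refine Finset.sum_congr rfl fun σ _ => ?_
  rw [Finset.prod_mul_distrib, Finset.prod_const, Finset.card_univ]
  ring

theorem theorem3p2 {S M : Type*} [CommSemiring S] [Semiring M]
    (τ : SemiringSymmetry S) (μ : S →+* M) (hT : IsExtendedTropical τ μ)
    (n : ℕ) (A : Matrix (Fin n) (Fin n) S) (hA : τ.Nonsingular A)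
    (k : ℕ) (hk : k ≤ n) (I J : KSubset (Fin n) k) :
    τ.det A * τ.compound (n - k) (τ.altDiagonal n * τ.quasiInverse A * τ.altDiagonal n)
        J.compl I.compl =
      τ.det A * τ.compound (n - k) (Ring.inverse (τ.det A) • τ.compound (n - 1) A)
        I.complMap J.complMap ∧
    τ.CircGE
      (τ.det A * τ.compound (n - k) (τ.altDiagonal n * τ.quasiInverse A * τ.altDiagonal n)
        J.compl I.compl)
      (τ.compound k A I J) := by
  rw [SemiringSymmetry.compound_quasiInverse_compl]
  refine ⟨by rw [SemiringSymmetry.compound_compound_complMap], ?_⟩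
  have hX := SemiringSymmetry.Dominates.mvPolynomialX (τ := τ) A
  -- Jacobi's identity, multiplied by `det A`, transfers from integer polynomials to `A`.
  have hminors : τ.CircGE
      (τ.det A * τ.det (fun (i : I.compl.1) (j : J.compl.1) => τ.minor A i j))
      (τ.det A ^ (n - k) * τ.compound k A I J) := by
    rw [hT.det_pow_mul_compound_eq_evalReduced hA, ← SemiringSymmetry.ofRing_jacobi]
    exact (SemiringSymmetry.Dominates.det hX).mul
      (SemiringSymmetry.Dominates.det fun i j => SemiringSymmetry.Dominates.det fun s t => hX s t)
  have hcard : Fintype.card I.compl.1 = n - k := by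
    rw [Fintype.card_coe]
    exact I.compl.2
  have hinv : Ring.inverse (τ.det A) ^ (n - k) * τ.det A ^ (n - k) = 1 := by
    rw [← mul_pow, Ring.inverse_mul_cancel _ hA, one_pow]
  have hscaled := hminors.mul_left (Ring.inverse (τ.det A) ^ (n - k))
  rw [← mul_assoc, ← mul_assoc, hinv, one_mul] at hscaled
  rw [SemiringSymmetry.det_const_mul τ _ (fun (i : I.compl.1) (j : J.compl.1) => τ.minor A i j),
    hcard, ← mul_assoc, mul_comm (τ.det A)]
  exact hscaled
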